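/- Let $\mathcal K$ be a finite set of agents, $\Theta$ a finite set of hypotheses, $\theta^\circ\in\Theta$ the true one. Agent $k$ has likelihood functions $L_k(\cdot\mid\theta)$, $\theta\in\Theta$, which are probability densities with respect to a $\sigma$-finite measure on its observation space. At each time $i\ge 1$ agent $k$ receives an observation $\xi_{k,i}$ with density $L_k(\cdot\mid\theta^\circ)$; the vectors $(\xi_{k,i})_{k\in\mathcal K}$ are i.i.d. over $i$, with arbitrary dependence between agents. Let $\pi_k>0$, $\sum_k\pi_k=1$. Agent $k$ starts from a probability mass function $\mu_{k,0}$ on $\Theta$ (for instance a common one, $\mu_{k,0}=\mu_0$). For $i\ge 1$, $$\psi_{k,i}(\theta)=\frac{L_k(\xi_{k,i}\mid\theta)\,\mu_{k,i-1}(\theta)}{\sum_{\theta'\in\Theta}L_k(\xi_{k,i}\mid\theta')\,\mu_{k,i-1}(\theta')},\qquad \mu_i(\theta)=\sum_{k\in\mathcal K}\pi_k\,\psi_{k,i}(\theta),$$ where $\mu_{k,i}=\mu_i$ for all $k$ and all $i\ge 1$. Assume that $D_{\mathrm{KL}}(L_k(\cdot\mid\theta^\circ)\,\|\,L_k(\cdot\mid\theta'))<\infty$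 for all $k$ and $\theta'$, and (global identifiability) that for each $\theta'\ne\theta^\circ$ there is an agent $k$ with $D_{\mathrm{KL}}(L_k(\cdot\mid\theta^\circ)\,\|\,L_k(\cdot\mid\theta'))>0$. Fix $\theta\ne\theta^\circ$, and assume that $\mu_{k,0}(\theta^\circ)>0$ for at least one $k$ and $\mu_{k,0}(\theta)>0$ for at least one $k$. Put $$r_{k,i}=\frac{L_k(\xi_{k,i}\mid\theta)}{L_k(\xi_{k,i}\mid\theta^\circ)},\qquad \rho_A=-\mathbb E\Big[\log\sum_{k}\pi_k r_{k,i}\Big],\qquad \sigma_A^2=\mathrm{Var}\Big[\log\sum_{k}\pi_k r_{k,i}\Big]$$ (these do not depend on $i$). If $0<\sigma_A^2<\infty$, then for every $t\in\mathbb R$ $$\lim_{i\to\infty}\Pr\left(\frac{\log\mu_i(\theta)+\rho_A\, i}{\sigma_A\sqrt i}\le t\right)=\Phi(t),$$ where $\Phi$ is the standard Gaussian cumulative distribution function. -/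

import Mathlib

open MeasureTheory ProbabilityTheory Filter Topology
open scoped ENNReal

/-- The local likelihood models `L(· | θ)`, `θ : Θ`, of one agent with observation space `X`:
a family of probability densities with respect to a common σ-finite reference measure
(Lebesgue measure for densities, counting measure for mass functions). -/
structure LikelihoodModel (Θ X : Type*) [MeasurableSpace X] where
  /-- The reference measure. -/
  ref : Measure X
  sigmaFinite_ref : SigmaFinite ref
  /-- `lik θ x` is the likelihood `L(x | θ)`. -/
  lik : Θ → X → ℝ
  measurable_lik : ∀ θ, Measurable (lik θ)
  lik_nonneg : ∀ θ x, 0 ≤ lik θ x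
  lintegral_lik : ∀ θ, ∫⁻ x, ENNReal.ofReal (lik θ x) ∂ref = 1

/-- The distribution on the observation space whose density is `L(· | θ)`. -/
noncomputable def LikelihoodModel.law {Θ X : Type*} [MeasurableSpace X]
    (M : LikelihoodModel Θ X) (θ : Θ) : Measure X :=
  M.ref.withDensity fun x => ENNReal.ofReal (M.lik θ x)

/-- The Bayesian (adapt) step of one agent: `ψ(θ) ∝ L(x | θ) b(θ)`, normalized over `Θ`. -/
noncomputable def adapt {Θ X : Type*} [Fintype Θ] [MeasurableSpace X]
    (M : LikelihoodModel Θ X) (b : Θ → ℝ) (x : X) (θ : Θ) : ℝ :=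
  M.lik θ x * b θ / ∑ θ', M.lik θ' x * b θ'

/-- Arithmetic-average pooling: `∑ k, π_k ψ_k(θ)`. -/
noncomputable def poolAA {K Θ : Type*} [Fintype K] (π : K → ℝ) (ψ : K → Θ → ℝ) (θ : Θ) : ℝ :=
  ∑ k, π k * ψ k θ

/-- The belief held by agent `k` at time `i` in the star-topology scheme with arithmetic-average
pooling. At time `0` it is the agent's initial belief. At each later time it is the belief `μ_i`
that the server broadcasts, which is the same for all agents.
`x n k` is the observation that agent `k` receives at time `n + 1`. -/
noncomputable def beliefAA {K Θ : Type*} [Fintype K] [Fintype Θ] {X : K → Type*}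
    [∀ k, MeasurableSpace (X k)] (M : ∀ k, LikelihoodModel Θ (X k)) (π : K → ℝ)
    (prior : K → Θ → ℝ) (x : ℕ → ∀ k, X k) : ℕ → K → Θ → ℝ
  | 0 => prior
  | n + 1 => fun _ => poolAA π fun l => adapt (M l) (beliefAA M π prior x n l) (x n l)

/-- The likelihood ratio `r_k = L_k(x | θ) / L_k(x | θ₀)`. -/
noncomputable def likRatio {Θ X : Type*} [MeasurableSpace X]
    (M : LikelihoodModel Θ X) (θ₀ θ : Θ) (x : X) : ℝ :=
  M.lik θ x / M.lik θ₀ x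

/-- `log (∑ k, π_k r_k)` as a function of the vector of simultaneous observations. -/
noncomputable def logMixRatio {K Θ : Type*} [Fintype K] {X : K → Type*}
    [∀ k, MeasurableSpace (X k)] (M : ∀ k, LikelihoodModel Θ (X k)) (π : K → ℝ)
    (θ₀ θ : Θ) (x : ∀ k, X k) : ℝ :=
  Real.log (∑ k, π k * likRatio (M k) θ₀ θ (x k))

/-! Let `z` be the predictive likelihood of an agent relative to the truth: `mixtureRatio` at its
current belief. From time `1` on the agents share one belief, and each step multiplies `μ(θ)` by `∑
π_l r_l / z_l`. Without the `z_l`, `log μ_i(θ)` would be a sum of i.i.d. terms `logMixRatio`, up to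
an initial term, and the CLT would apply. The error caused by the `z_l` is at most `∑ |log z_l|` per
step, so it suffices that these errors add up to `o(√i)` almost surely.

For this, apply the recursion to `θ₀`, where `r = 1`. Since `log μ_i(θ₀) ≤ 0`, the increments `log ∑
π_l / z_l ≥ ∑ π_l · 2(1 - √z_l)` have bounded sums. As `(1 - √z)² = 2(1 - √z) + (z - 1)` and `E z ≤
1`, the expected sum of `(1 - √z)²` is finite (`ae_summable_one_sub_sqrt_mixtureRatio_sq`). Hence `∑
(log z)² < ∞` almost surely, and Cauchy–Schwarz gives `o(√i)`
(`tendsto_log_beliefAA_sub_sum_div_sqrt`). Slutsky's theorem finishes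
(`tendsto_cdf_gaussian_of_tendsto_sub_sum`). -/

/-! ### Square-summable sequences. -/

section Sequences

/-- Cauchy–Schwarz on a tail of small square sum; the finite head is killed by `√n`. -/
theorem tendsto_sum_div_sqrt_of_summable_sq {a : ℕ → ℝ} (ha : ∀ n, 0 ≤ a n)
    (hs : Summable fun n => a n ^ 2) :
    Tendsto (fun n : ℕ => (∑ j ∈ Finset.range n, a j) / √(n : ℝ)) atTop (𝓝 0) := by
  rw [Metric.tendsto_atTop]
  intro ε hε
  obtain ⟨m, hm⟩ : ∃ m, ∑' n, a (n + m) ^ 2 < (ε / 2) ^ 2 :=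
    ((tendsto_sum_nat_add fun n => a n ^ 2).eventually_lt_const (by positivity)).exists
  have hsm : Summable fun n => a (n + m) ^ 2 := (summable_nat_add_iff m).2 hs
  have htail (n : ℕ) : ∑ j ∈ Finset.range n, a (j + m) ≤ √(n : ℝ) * (ε / 2) := by
    refine abs_le_of_sq_le_sq' ?_ (by positivity) |>.2
    calc (∑ j ∈ Finset.range n, a (j + m)) ^ 2
        ≤ n * ∑ j ∈ Finset.range n, a (j + m) ^ 2 := by
          simpa using sq_sum_le_card_mul_sum_sq (s := Finset.range n) (f := fun j => a (j + m))
      _ ≤ n * (ε / 2) ^ 2 := by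
          gcongr
          exact (hsm.sum_le_tsum _ fun _ _ => sq_nonneg _).trans hm.le
      _ = (√(n : ℝ) * (ε / 2)) ^ 2 := by rw [mul_pow, Real.sq_sqrt (Nat.cast_nonneg n)]
  set c := ∑ j ∈ Finset.range m, a j
  have hc : Tendsto (fun n : ℕ => c / √(n : ℝ)) atTop (𝓝 0) :=
    tendsto_const_nhds.div_atTop (Real.tendsto_sqrt_atTop.comp tendsto_natCast_atTop_atTop)
  obtain ⟨N, hN⟩ := eventually_atTop.1 (hc.eventually_lt_const (half_pos hε))
  refine ⟨max N (m + 1), fun n hn => ?_⟩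
  have hnN : N ≤ n := (le_max_left _ _).trans hn
  have hnm : m + 1 ≤ n := (le_max_right _ _).trans hn
  have hn0 : 0 < √(n : ℝ) := Real.sqrt_pos.2 (by exact_mod_cast (by omega : 0 < n))
  have hsum0 : 0 ≤ ∑ j ∈ Finset.range n, a j := Finset.sum_nonneg fun _ _ => ha _
  rw [Real.dist_eq, sub_zero, abs_of_nonneg (by positivity)]
  have hsplit : ∑ j ∈ Finset.range n, a j = c + ∑ j ∈ Finset.range (n - m), a (j + m) := by
    conv_lhs => rw [show n = m + (n - m) by omega, Finset.sum_range_add]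
    simp [c, add_comm]
  have h1 : ∑ j ∈ Finset.range (n - m), a (j + m) ≤ √(n : ℝ) * (ε / 2) :=
    (htail _).trans (by gcongr; omega)
  have h2 : (∑ j ∈ Finset.range (n - m), a (j + m)) / √(n : ℝ) ≤ ε / 2 := by
    rw [div_le_iff₀ hn0]; linarith
  rw [hsplit, add_div]
  linarith [hN n hnN]

/-- Summability forces `√z → 1`, and near `1` the logarithm is `O(√z - 1)`. -/
theorem summable_log_sq_of_summable_one_sub_sqrt_sq {z : ℕ → ℝ}
    (hs : Summable fun n => (1 - √(z n)) ^ 2) : Summable fun n => Real.log (z n) ^ 2 := by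
  have h0 : Tendsto (fun n => √(z n)) atTop (𝓝 1) := by
    have h := hs.tendsto_atTop_zero.sqrt
    simp only [Real.sqrt_sq_eq_abs, Real.sqrt_zero] at h
    simpa using ((tendsto_zero_iff_abs_tendsto_zero _).2 h).const_sub 1
  have hO : (fun n => Real.log (√(z n))) =O[atTop] fun n => √(z n) - 1 := by
    have := (Real.hasDerivAt_log one_ne_zero).isBigO_sub
    simp only [Real.log_one, sub_zero] at this
    exact this.comp_tendsto h0
  have hO2 : (fun n => Real.log (z n) ^ 2) =O[atTop] fun n => (1 - √(z n)) ^ 2 := by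
    have h4 : (fun n => Real.log (z n) ^ 2) =ᶠ[atTop]
        fun n => 4 * Real.log (√(z n)) ^ 2 := by
      filter_upwards [h0.eventually_const_lt zero_lt_one] with n hn
      rw [Real.log_sqrt (Real.sqrt_pos.1 hn).le]; ring
    refine h4.trans_isBigO (Asymptotics.IsBigO.const_mul_left ?_ 4)
    refine (hO.pow 2).congr_right fun n => by ring
  exact summable_of_isBigO_nat hs hO2

end Sequences

/-! ### Logarithms of weighted averages. -/

section LogAverage

variable {K : Type*} [Fintype K]

/-- Every factor `1 / z k` lies between `exp (-L)` and `exp L`, with `L` the right-hand side. The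
bound is uniform in `r`. -/
theorem abs_log_sum_mul_div_sub_log_sum_mul_le {π r z : K → ℝ} (hπ : ∀ k, 0 < π k)
    (hr : ∀ k, 0 < r k) (hz : ∀ k, 0 < z k) :
    |Real.log (∑ k, π k * (r k / z k)) - Real.log (∑ k, π k * r k)| ≤
      ∑ k, |Real.log (z k)| := by
  rcases isEmpty_or_nonempty K with hK | hK
  · simp
  set L := ∑ k, |Real.log (z k)|
  have hL (k : K) : |Real.log (z k)| ≤ L :=
    Finset.single_le_sum (f := fun k => |Real.log (z k)|) (fun _ _ => abs_nonneg _)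
      (Finset.mem_univ k)
  have hlo (k : K) : Real.exp (-L) ≤ (z k)⁻¹ := by
    rw [Real.exp_neg]
    refine inv_anti₀ (hz k) ?_
    rw [← Real.log_le_iff_le_exp (hz k)]
    exact (le_abs_self _).trans (hL k)
  have hhi (k : K) : (z k)⁻¹ ≤ Real.exp L := by
    rw [← Real.log_le_iff_le_exp (inv_pos.2 (hz k)), Real.log_inv]
    exact (neg_le_abs _).trans (hL k)
  have hpos : 0 < ∑ k, π k * r k :=
    Finset.sum_pos (fun k _ => mul_pos (hπ k) (hr k)) Finset.univ_nonempty
  have hpos' : 0 < ∑ k, π k * (r k / z k) :=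
    Finset.sum_pos (fun k _ => mul_pos (hπ k) (div_pos (hr k) (hz k))) Finset.univ_nonempty
  have h1 : (∑ k, π k * r k) * Real.exp (-L) ≤ ∑ k, π k * (r k / z k) := by
    rw [Finset.sum_mul]
    refine Finset.sum_le_sum fun k _ => ?_
    rw [div_eq_mul_inv, ← mul_assoc]
    exact mul_le_mul_of_nonneg_left (hlo k) (mul_pos (hπ k) (hr k)).le
  have h2 : ∑ k, π k * (r k / z k) ≤ (∑ k, π k * r k) * Real.exp L := by
    rw [Finset.sum_mul]
    refine Finset.sum_le_sum fun k _ => ?_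
    rw [div_eq_mul_inv, ← mul_assoc]
    exact mul_le_mul_of_nonneg_left (hhi k) (mul_pos (hπ k) (hr k)).le
  have h1' := Real.log_le_log (by positivity) h1
  have h2' := Real.log_le_log hpos' h2
  rw [Real.log_mul hpos.ne' (Real.exp_pos _).ne', Real.log_exp] at h1' h2'
  rw [abs_le]
  constructor <;> linarith

/-- Jensen's inequality, then `log √z ≤ √z - 1`. -/
theorem two_mul_one_sub_sqrt_le_log_sum_inv {π z : K → ℝ} (hπ : ∀ k, 0 < π k)
    (hsum : ∑ k, π k = 1) (hz : ∀ k, 0 < z k) :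
    ∑ k, π k * (2 * (1 - √(z k))) ≤ Real.log (∑ k, π k * (z k)⁻¹) := by
  have hJ : ∑ k, π k * Real.log (z k)⁻¹ ≤ Real.log (∑ k, π k * (z k)⁻¹) := by
    simpa using strictConcaveOn_log_Ioi.concaveOn.le_map_sum (t := Finset.univ) (w := π)
      (p := fun k => (z k)⁻¹) (fun k _ => (hπ k).le) hsum fun k _ => inv_pos.2 (hz k)
  refine le_trans (Finset.sum_le_sum fun k _ => mul_le_mul_of_nonneg_left ?_ (hπ k).le) hJ
  have h := Real.log_le_sub_one_of_pos (Real.sqrt_pos.2 (hz k))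
  rw [Real.log_sqrt (hz k).le] at h
  rw [Real.log_inv]
  linarith

end LogAverage

/-! ### Likelihood ratios under the true law. -/

section LikelihoodRatio

variable {Θ X : Type*} [MeasurableSpace X] (M : LikelihoodModel Θ X)

theorem likRatio_nonneg (θ₀ θ : Θ) (x : X) : 0 ≤ likRatio M θ₀ θ x :=
  div_nonneg (M.lik_nonneg _ _) (M.lik_nonneg _ _)

theorem measurable_likRatio (θ₀ θ : Θ) : Measurable (likRatio M θ₀ θ) :=
  (M.measurable_lik θ).div (M.measurable_lik θ₀)

theorem lintegral_likRatio_le_one (θ₀ θ : Θ) :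
    ∫⁻ x, ENNReal.ofReal (likRatio M θ₀ θ x) ∂M.law θ₀ ≤ 1 := by
  rw [LikelihoodModel.law, lintegral_withDensity_eq_lintegral_mul _
    (M.measurable_lik θ₀).ennreal_ofReal (measurable_likRatio M θ₀ θ).ennreal_ofReal,
    ← M.lintegral_lik θ]
  refine lintegral_mono fun x => ?_
  -- `L₀ · (L / L₀) = L · (L₀ / L₀) ≤ L`, also where `L₀ = 0`; mass of `L` there makes the
  -- inequality strict.
  rw [Pi.mul_apply, ← ENNReal.ofReal_mul (M.lik_nonneg _ _), likRatio, mul_div_left_comm]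
  exact ENNReal.ofReal_le_ofReal (mul_le_of_le_one_right (M.lik_nonneg _ _) (div_self_le_one _))

theorem ae_law_lik_pos (θ : Θ) : ∀ᵐ x ∂M.law θ, 0 < M.lik θ x := by
  rw [LikelihoodModel.law, ae_withDensity_iff (M.measurable_lik θ).ennreal_ofReal]
  exact ae_of_all _ fun x hx => by simpa using hx

theorem ae_law_lik_pos_of_klDiv_lt_top {θ₀ θ : Θ}
    (h : InformationTheory.klDiv (M.law θ₀) (M.law θ) < ∞) : ∀ᵐ x ∂M.law θ₀, 0 < M.lik θ x :=
  (InformationTheory.klDiv_ne_top_iff.1 h.ne).1.ae_le (ae_law_lik_pos M θ)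

end LikelihoodRatio

/-! ### Pathwise analysis of the belief recursion. -/

section Recursion

variable {K Θ : Type*} [Fintype K] [Fintype Θ]

/-- The likelihood under the mixture of the hypotheses with weights `b`, relative to the
likelihood under `θ₀`. -/
noncomputable def mixtureRatio {X : Type*} [MeasurableSpace X] (M : LikelihoodModel Θ X)
    (θ₀ : Θ) (b : Θ → ℝ) (x : X) : ℝ :=
  ∑ θ', b θ' * likRatio M θ₀ θ' x

section OneAgent

variable {X : Type*} [MeasurableSpace X] (M : LikelihoodModel Θ X)

theorem mul_likRatio_le_mixtureRatio {b : Θ → ℝ} (hb : ∀ θ', 0 ≤ b θ') (θ₀ θ : Θ) (x : X) :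
    b θ * likRatio M θ₀ θ x ≤ mixtureRatio M θ₀ b x :=
  Finset.single_le_sum (f := fun θ' => b θ' * likRatio M θ₀ θ' x)
    (fun θ' _ => mul_nonneg (hb θ') (likRatio_nonneg M θ₀ θ' x)) (Finset.mem_univ θ)

theorem mixtureRatio_nonneg {b : Θ → ℝ} (hb : ∀ θ', 0 ≤ b θ') (θ₀ : Θ) (x : X) :
    0 ≤ mixtureRatio M θ₀ b x :=
  Finset.sum_nonneg fun θ' _ => mul_nonneg (hb θ') (likRatio_nonneg M θ₀ θ' x)

theorem adapt_eq_mul_div_mixtureRatio (b : Θ → ℝ) {θ₀ : Θ} {x : X} (hx : 0 < M.lik θ₀ x)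
    (θ : Θ) : adapt M b x θ = b θ * (likRatio M θ₀ θ x / mixtureRatio M θ₀ b x) := by
  have h : ∑ θ', M.lik θ' x * b θ' = mixtureRatio M θ₀ b x * M.lik θ₀ x := by
    rw [mixtureRatio, Finset.sum_mul]
    refine Finset.sum_congr rfl fun θ' _ => ?_
    rw [likRatio, mul_assoc, div_mul_cancel₀ _ hx.ne', mul_comm]
  rw [adapt, h, likRatio, div_div, mul_comm (M.lik θ₀ x), mul_comm (M.lik θ x), mul_div_assoc]

theorem adapt_nonneg {b : Θ → ℝ} (hb : ∀ θ', 0 ≤ b θ') (x : X) (θ : Θ) : 0 ≤ adapt M b x θ :=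
  div_nonneg (mul_nonneg (M.lik_nonneg _ _) (hb _))
    (Finset.sum_nonneg fun _ _ => mul_nonneg (M.lik_nonneg _ _) (hb _))

/-- Not an equality: if the normalizer vanishes, the quotients are `0`. -/
theorem sum_adapt_le_one (b : Θ → ℝ) (x : X) : ∑ θ, adapt M b x θ ≤ 1 := by
  simp_rw [adapt, ← Finset.sum_div]
  exact div_self_le_one _

end OneAgent

variable {X : K → Type*} [∀ k, MeasurableSpace (X k)] {M : ∀ k, LikelihoodModel Θ (X k)}
  {π : K → ℝ} {prior : K → Θ → ℝ} {x : ℕ → ∀ k, X k} {θ₀ θ : Θ}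

theorem beliefAA_nonneg (hπ : ∀ k, 0 < π k) (hprior : ∀ k, prior k ∈ stdSimplex ℝ Θ) :
    ∀ (n : ℕ) (k : K) (θ : Θ), 0 ≤ beliefAA M π prior x n k θ
  | 0, k, θ => (hprior k).1 θ
  | n + 1, _, _ => Finset.sum_nonneg fun l _ =>
      mul_nonneg (hπ l).le (adapt_nonneg (M l) (beliefAA_nonneg hπ hprior n l) _ _)

theorem sum_beliefAA_le_one (hπ : ∀ k, 0 < π k) (hsum : ∑ k, π k = 1)
    (hprior : ∀ k, prior k ∈ stdSimplex ℝ Θ) (n : ℕ) (k : K) :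
    ∑ θ, beliefAA M π prior x n k θ ≤ 1 := by
  cases n with
  | zero => exact (hprior k).2.le
  | succ n =>
    simp only [beliefAA, poolAA]
    rw [Finset.sum_comm]
    simp_rw [← Finset.mul_sum]
    calc _ ≤ ∑ l, π l * 1 := Finset.sum_le_sum fun l _ =>
            mul_le_mul_of_nonneg_left (sum_adapt_le_one _ _ _) (hπ l).le
      _ = 1 := by simpa using hsum

theorem beliefAA_le_one (hπ : ∀ k, 0 < π k) (hsum : ∑ k, π k = 1)
    (hprior : ∀ k, prior k ∈ stdSimplex ℝ Θ) (n : ℕ) (k : K) (θ : Θ) :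
    beliefAA M π prior x n k θ ≤ 1 :=
  (Finset.single_le_sum (fun θ' _ => beliefAA_nonneg hπ hprior n k θ')
    (Finset.mem_univ θ)).trans (sum_beliefAA_le_one hπ hsum hprior n k)

theorem mul_div_mixtureRatio_le_beliefAA_succ (hπ : ∀ k, 0 < π k)
    (hprior : ∀ k, prior k ∈ stdSimplex ℝ Θ) (h₀ : ∀ n k, 0 < (M k).lik θ₀ (x n k))
    (n : ℕ) (k l : K) (θ : Θ) :
    π l * (beliefAA M π prior x n l θ * (likRatio (M l) θ₀ θ (x n l) /
      mixtureRatio (M l) θ₀ (beliefAA M π prior x n l) (x n l))) ≤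
      beliefAA M π prior x (n + 1) k θ := by
  rw [← adapt_eq_mul_div_mixtureRatio (M l) _ (h₀ n l)]
  exact Finset.single_le_sum
    (f := fun l => π l * adapt (M l) (beliefAA M π prior x n l) (x n l) θ)
    (fun l _ => mul_nonneg (hπ l).le (adapt_nonneg (M l) (beliefAA_nonneg hπ hprior n l) _ _))
    (Finset.mem_univ l)

theorem beliefAA_succ_pos (hπ : ∀ k, 0 < π k) (hprior : ∀ k, prior k ∈ stdSimplex ℝ Θ)
    (h₀ : ∀ n k, 0 < (M k).lik θ₀ (x n k)) (hθ : ∀ n k, 0 < (M k).lik θ (x n k)) (n : ℕ) (k l : K)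
    (hl : 0 < beliefAA M π prior x n l θ) : 0 < beliefAA M π prior x (n + 1) k θ := by
  have hr : 0 < likRatio (M l) θ₀ θ (x n l) := div_pos (hθ n l) (h₀ n l)
  have hz : 0 < mixtureRatio (M l) θ₀ (beliefAA M π prior x n l) (x n l) :=
    (mul_pos hl hr).trans_le
      (mul_likRatio_le_mixtureRatio (M l) (beliefAA_nonneg hπ hprior n l) θ₀ θ _)
  exact (mul_pos (hπ l) (mul_pos hl (div_pos hr hz))).trans_le
    (mul_div_mixtureRatio_le_beliefAA_succ hπ hprior h₀ n k l θ)

/-- One pooling step spreads positivity from a single agent to all, hence the index `n + 1`. -/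
theorem beliefAA_pos (hπ : ∀ k, 0 < π k) (hprior : ∀ k, prior k ∈ stdSimplex ℝ Θ)
    (h₀ : ∀ n k, 0 < (M k).lik θ₀ (x n k)) (hθ : ∀ n k, 0 < (M k).lik θ (x n k))
    (hex : ∃ k, 0 < prior k θ) (n : ℕ) (k : K) : 0 < beliefAA M π prior x (n + 1) k θ := by
  obtain ⟨l, hl⟩ := hex
  induction n generalizing k with
  | zero => exact beliefAA_succ_pos hπ hprior h₀ hθ 0 k l hl
  | succ n ih => exact beliefAA_succ_pos hπ hprior h₀ hθ (n + 1) k k (ih k)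

theorem mixtureRatio_beliefAA_pos (hπ : ∀ k, 0 < π k) (hprior : ∀ k, prior k ∈ stdSimplex ℝ Θ)
    (h₀ : ∀ n k, 0 < (M k).lik θ₀ (x n k)) (hex : ∃ k, 0 < prior k θ₀) (n : ℕ) (k : K) :
    0 < mixtureRatio (M k) θ₀ (beliefAA M π prior x (n + 1) k) (x (n + 1) k) :=
  (mul_pos (beliefAA_pos hπ hprior h₀ h₀ hex n k) (div_pos (h₀ _ k) (h₀ _ k))).trans_le
    (mul_likRatio_le_mixtureRatio (M k) (beliefAA_nonneg hπ hprior _ k) θ₀ θ₀ _)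

/-- The belief factors out of the pooling sum because it is common to all agents, which can fail at
time `0`. -/
theorem beliefAA_add_two (h₀ : ∀ n k, 0 < (M k).lik θ₀ (x n k)) (n : ℕ) (k : K) (θ : Θ) :
    beliefAA M π prior x (n + 2) k θ = beliefAA M π prior x (n + 1) k θ *
      ∑ l, π l * (likRatio (M l) θ₀ θ (x (n + 1) l) /
        mixtureRatio (M l) θ₀ (beliefAA M π prior x (n + 1) l) (x (n + 1) l)) := by
  rw [Finset.mul_sum]
  change ∑ l, π l * adapt (M l) (beliefAA M π prior x (n + 1) l) (x (n + 1) l) θ = _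
  refine Finset.sum_congr rfl fun l _ => ?_
  rw [adapt_eq_mul_div_mixtureRatio (M l) _ (h₀ _ l)]
  change π l * (beliefAA M π prior x (n + 1) k θ * _) = _
  ring

/-- The right side is affine in the ratios `z`, so `E z ≤ 1` bounds its expectation uniformly in
`N`. -/
theorem sum_mul_one_sub_sqrt_mixtureRatio_sq_le (hπ : ∀ k, 0 < π k) (hsum : ∑ k, π k = 1)
    (hprior : ∀ k, prior k ∈ stdSimplex ℝ Θ) (h₀ : ∀ n k, 0 < (M k).lik θ₀ (x n k))
    {k₀ : K} (hk₀ : 0 < prior k₀ θ₀) (N : ℕ) :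
    ∑ j ∈ Finset.range N, ∑ k, π k *
      (1 - √(mixtureRatio (M k) θ₀ (beliefAA M π prior x (j + 1) k) (x (j + 1) k))) ^ 2 ≤
    -Real.log (π k₀ * prior k₀ θ₀) + mixtureRatio (M k₀) θ₀ (prior k₀) (x 0 k₀) +
      ∑ j ∈ Finset.range N, ∑ k, π k *
        (mixtureRatio (M k) θ₀ (beliefAA M π prior x (j + 1) k) (x (j + 1) k) - 1) := by
  set z : ℕ → K → ℝ := fun j k =>
    mixtureRatio (M k) θ₀ (beliefAA M π prior x j k) (x j k) with hz
  have hzpos (j : ℕ) (k : K) : 0 < z (j + 1) k :=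
    mixtureRatio_beliefAA_pos hπ hprior h₀ ⟨k₀, hk₀⟩ j k
  have hone (j : ℕ) (k : K) : likRatio (M k) θ₀ θ₀ (x j k) = 1 := div_self (h₀ j k).ne'
  -- The first step is bounded through agent `k₀` alone; `log z ≤ z` replaces the logarithm by an
  -- integrable term.
  have hinit : Real.log (π k₀ * prior k₀ θ₀) - z 0 k₀ ≤
      Real.log (beliefAA M π prior x 1 k₀ θ₀) := by
    have hz0 : 0 < z 0 k₀ := by
      refine hk₀.trans_le ?_
      have := mul_likRatio_le_mixtureRatio (M k₀) (hprior k₀).1 θ₀ θ₀ (x 0 k₀)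
      rwa [hone, mul_one] at this
    have h := mul_div_mixtureRatio_le_beliefAA_succ (prior := prior) hπ hprior h₀ 0 k₀ k₀ θ₀
    rw [hone, one_div, ← mul_assoc] at h
    have hp : 0 < π k₀ * prior k₀ θ₀ := mul_pos (hπ _) hk₀
    have h' := Real.log_le_log (mul_pos hp (inv_pos.2 hz0)) h
    rw [Real.log_mul hp.ne' (inv_pos.2 hz0).ne', Real.log_inv] at h'
    linarith [Real.log_le_sub_one_of_pos hz0]
  have hstep : ∀ N : ℕ, Real.log (beliefAA M π prior x 1 k₀ θ₀) +
      ∑ j ∈ Finset.range N, ∑ k, π k * (2 * (1 - √(z (j + 1) k))) ≤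
      Real.log (beliefAA M π prior x (N + 1) k₀ θ₀) := by
    intro N
    induction N with
    | zero => simp
    | succ N ih =>
      have hJ := two_mul_one_sub_sqrt_le_log_sum_inv hπ hsum (hzpos N)
      have hpos : 0 < ∑ k, π k * (z (N + 1) k)⁻¹ :=
        Finset.sum_pos (fun k _ => mul_pos (hπ k) (inv_pos.2 (hzpos N k))) ⟨k₀, Finset.mem_univ _⟩
      rw [Finset.sum_range_succ, beliefAA_add_two h₀]
      simp_rw [hone, one_div]
      rw [Real.log_mul (beliefAA_pos hπ hprior h₀ h₀ ⟨k₀, hk₀⟩ N k₀).ne' hpos.ne']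
      linarith
  have hle : Real.log (beliefAA M π prior x (N + 1) k₀ θ₀) ≤ 0 :=
    Real.log_nonpos (beliefAA_nonneg hπ hprior _ _ _) (beliefAA_le_one hπ hsum hprior _ _ _)
  have hsq : ∑ j ∈ Finset.range N, ∑ k, π k * (1 - √(z (j + 1) k)) ^ 2 =
      ∑ j ∈ Finset.range N, ∑ k, π k * (2 * (1 - √(z (j + 1) k))) +
      ∑ j ∈ Finset.range N, ∑ k, π k * (z (j + 1) k - 1) := by
    simp_rw [← Finset.sum_add_distrib]
    refine Finset.sum_congr rfl fun j _ => Finset.sum_congr rfl fun k _ => ?_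
    have := Real.sq_sqrt (hzpos j k).le
    rw [← mul_add]
    congr 1
    linear_combination this
  have := hstep N
  change _ ≤ -Real.log (π k₀ * prior k₀ θ₀) + z 0 k₀ + _
  linarith

theorem abs_log_beliefAA_sub_sum_logMixRatio_le (hπ : ∀ k, 0 < π k)
    (hprior : ∀ k, prior k ∈ stdSimplex ℝ Θ) (h₀ : ∀ n k, 0 < (M k).lik θ₀ (x n k))
    (hθ : ∀ n k, 0 < (M k).lik θ (x n k)) (hex₀ : ∃ k, 0 < prior k θ₀)
    (hex : ∃ k, 0 < prior k θ) (k : K) (n : ℕ) :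
    |Real.log (beliefAA M π prior x (n + 1) k θ) -
        ∑ j ∈ Finset.range (n + 1), logMixRatio M π θ₀ θ (x j)| ≤
      |Real.log (beliefAA M π prior x 1 k θ) - logMixRatio M π θ₀ θ (x 0)| +
      ∑ j ∈ Finset.range n, ∑ l,
        |Real.log (mixtureRatio (M l) θ₀ (beliefAA M π prior x (j + 1) l) (x (j + 1) l))| := by
  have hz (j : ℕ) (l : K) := mixtureRatio_beliefAA_pos hπ hprior h₀ hex₀ j l
  have hr (j : ℕ) (l : K) : 0 < likRatio (M l) θ₀ θ (x j l) := div_pos (hθ j l) (h₀ j l)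
  induction n with
  | zero => simp
  | succ n ih =>
    have hs := abs_log_sum_mul_div_sub_log_sum_mul_le hπ (hr (n + 1)) (hz n)
    have hpos : 0 < ∑ l, π l * (likRatio (M l) θ₀ θ (x (n + 1) l) /
        mixtureRatio (M l) θ₀ (beliefAA M π prior x (n + 1) l) (x (n + 1) l)) :=
      Finset.sum_pos (fun l _ => mul_pos (hπ l) (div_pos (hr _ l) (hz n l)))
        ⟨k, Finset.mem_univ _⟩
    rw [beliefAA_add_two h₀, Real.log_mul (beliefAA_pos hπ hprior h₀ hθ hex n k).ne' hpos.ne',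
      Finset.sum_range_succ _ (n + 1), add_sub_add_comm]
    refine (abs_add_le _ _).trans ((add_le_add ih hs).trans_eq ?_)
    rw [Finset.sum_range_succ _ n, add_assoc]

theorem tendsto_log_beliefAA_sub_sum_div_sqrt (hπ : ∀ k, 0 < π k)
    (hprior : ∀ k, prior k ∈ stdSimplex ℝ Θ) (h₀ : ∀ n k, 0 < (M k).lik θ₀ (x n k))
    (hθ : ∀ n k, 0 < (M k).lik θ (x n k)) (hex₀ : ∃ k, 0 < prior k θ₀)
    (hex : ∃ k, 0 < prior k θ)
    (hs : Summable fun j => ∑ k, π k *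
      (1 - √(mixtureRatio (M k) θ₀ (beliefAA M π prior x (j + 1) k) (x (j + 1) k))) ^ 2) (k : K) :
    Tendsto (fun n : ℕ => (Real.log (beliefAA M π prior x n k θ) -
        ∑ j ∈ Finset.range n, logMixRatio M π θ₀ θ (x j)) / √(n : ℝ)) atTop (𝓝 0) := by
  set z : ℕ → K → ℝ := fun j k =>
    mixtureRatio (M k) θ₀ (beliefAA M π prior x j k) (x j k) with hz
  have hsk (l : K) : Summable fun j => (1 - √(z (j + 1) l)) ^ 2 := by
    have : Summable fun j => π l * (1 - √(z (j + 1) l)) ^ 2 :=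
      hs.of_nonneg_of_le (fun j => mul_nonneg (hπ l).le (sq_nonneg _)) fun j =>
        Finset.single_le_sum (f := fun l => π l * (1 - √(z (j + 1) l)) ^ 2)
          (fun l _ => mul_nonneg (hπ l).le (sq_nonneg _)) (Finset.mem_univ l)
    exact (summable_mul_left_iff (hπ l).ne').1 this
  have hlog (l : K) : Tendsto
      (fun n : ℕ => (∑ j ∈ Finset.range n, |Real.log (z (j + 1) l)|) / √(n : ℝ)) atTop (𝓝 0) := by
    refine tendsto_sum_div_sqrt_of_summable_sq (fun _ => abs_nonneg _) ?_
    simpa using summable_log_sq_of_summable_one_sub_sqrt_sq (hsk l)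
  set c := |Real.log (beliefAA M π prior x 1 k θ) - logMixRatio M π θ₀ θ (x 0)|
  have hc : Tendsto (fun n : ℕ => c / √(n : ℝ)) atTop (𝓝 0) :=
    tendsto_const_nhds.div_atTop (Real.tendsto_sqrt_atTop.comp tendsto_natCast_atTop_atTop)
  have hbound := hc.add (tendsto_finsetSum Finset.univ fun l _ => hlog l)
  simp only [Finset.sum_const_zero, add_zero] at hbound
  refine squeeze_zero_norm' ?_ hbound
  filter_upwards [eventually_ge_atTop 1] with n hn
  obtain ⟨m, rfl⟩ : ∃ m, n = m + 1 := ⟨n - 1, by omega⟩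
  rw [Real.norm_eq_abs, abs_div, abs_of_nonneg (Real.sqrt_nonneg _), ← Finset.sum_div, ← add_div]
  gcongr
  -- The bound has `m` terms; a nonnegative one is added to reach `m + 1`.
  refine (abs_log_beliefAA_sub_sum_logMixRatio_le hπ hprior h₀ hθ hex₀ hex k m).trans ?_
  rw [Finset.sum_comm]
  gcongr
  omega

end Recursion

/-! ### Almost sure summability and the central limit theorem. -/

section Probability

variable {Ω : Type*} [MeasurableSpace Ω] {P : Measure Ω}

theorem ae_summable_of_integral_sum_le {G : ℕ → Ω → ℝ} (h0 : ∀ n ω, 0 ≤ G n ω)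
    (hm : ∀ n, Measurable (G n)) (hi : ∀ n, Integrable (G n) P) {C : ℝ}
    (hC : ∀ N, ∫ ω, ∑ j ∈ Finset.range N, G j ω ∂P ≤ C) : ∀ᵐ ω ∂P, Summable fun n => G n ω := by
  have hfin : ∫⁻ ω, ∑' n, ENNReal.ofReal (G n ω) ∂P ≠ ∞ := by
    rw [lintegral_tsum fun n => (hm n).ennreal_ofReal.aemeasurable, ENNReal.tsum_eq_iSup_nat]
    refine ne_top_of_le_ne_top (ENNReal.ofReal_ne_top (r := C)) (iSup_le fun N => ?_)
    rw [← lintegral_finsetSum _ fun n _ => (hm n).ennreal_ofReal]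
    simp_rw [← ENNReal.ofReal_sum_of_nonneg fun n _ => h0 n _]
    rw [← ofReal_integral_eq_lintegral_ofReal (integrable_finsetSum _ fun n _ => hi n)
      (ae_of_all _ fun ω => Finset.sum_nonneg fun n _ => h0 n ω)]
    exact ENNReal.ofReal_le_ofReal (hC N)
  filter_upwards [ae_lt_top (Measurable.tsum fun n => (hm n).ennreal_ofReal) hfin] with ω hω
  have := ENNReal.summable_toReal hω.ne
  simpa [ENNReal.toReal_ofReal (h0 _ ω)] using this

/-- CLT for the standardized `Y`, Slutsky to pass to `V`, then the portmanteau theorem on `Set.Iic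
t`, whose frontier is Gaussian-null. -/
theorem tendsto_cdf_gaussian_of_tendsto_sub_sum [IsProbabilityMeasure P] {Y : ℕ → Ω → ℝ}
    (hindep : iIndepFun Y P) (hident : ∀ n, IdentDistrib (Y n) (Y 0) P P)
    (hL2 : MemLp (Y 0) 2 P) {ρ σ : ℝ} (hρ : ρ = -∫ ω, Y 0 ω ∂P) (hσ : σ = √(Var[Y 0; P]))
    (hσ_pos : 0 < σ) {V : ℕ → Ω → ℝ} (hV : ∀ n, Measurable (V n))
    (hlim : ∀ᵐ ω ∂P, Tendsto
      (fun n : ℕ => (V n ω - ∑ j ∈ Finset.range n, Y j ω) / √(n : ℝ)) atTop (𝓝 0)) (t : ℝ) :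
    Tendsto (fun n : ℕ => P.real {ω | (V n ω + ρ * n) / (σ * √(n : ℝ)) ≤ t}) atTop
      (𝓝 (cdf (gaussianReal 0 1) t)) := by
  have hint : Integrable (Y 0) P := hL2.integrable one_le_two
  set X : ℕ → Ω → ℝ := fun n ω => (Y n ω + ρ) / σ with hX
  have hCLT := tendstoInDistribution_inv_sqrt_mul_sum (X := X) (P := P)
    (HasLaw.id (μ := gaussianReal 0 1)) (by
      simp only [hX]
      rw [integral_div, integral_add hint (integrable_const _), hρ]
      simp) (by
      simp only [hX, Pi.pow_apply, div_pow]
      rw [integral_div, hρ]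
      simp_rw [← sub_eq_add_neg]
      rw [← variance_eq_integral hint.aemeasurable, hσ, Real.sq_sqrt (variance_nonneg _ _)]
      refine div_self fun h => ?_
      rw [h] at hσ
      simp [hσ] at hσ_pos)
    (hindep.comp (fun _ y => (y + ρ) / σ) fun _ => by fun_prop)
    (fun n => (hident n).comp (u := fun y => (y + ρ) / σ) (by fun_prop))
  have hZm (n : ℕ) : Measurable fun ω => (V n ω + ρ * n) / (σ * √(n : ℝ)) :=
    ((hV n).add_const _).div_const _
  have hZ : TendstoInDistribution (fun (n : ℕ) ω => (V n ω + ρ * n) / (σ * √(n : ℝ))) atTop id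
      (fun _ => P) (gaussianReal 0 1) := by
    refine tendstoInDistribution_of_tendstoInMeasure_sub _ _ hCLT ?_ fun n => (hZm n).aemeasurable
    refine tendstoInMeasure_of_tendsto_ae (fun n =>
      ((hZm n).aemeasurable.sub (hCLT.forall_aemeasurable n)).aestronglyMeasurable) ?_
    filter_upwards [hlim] with ω hω
    have h := hω.div_const σ
    rw [zero_div] at h
    refine h.congr fun n => ?_
    simp only [hX, Pi.sub_apply, ← Finset.sum_div, Finset.sum_add_distrib, Finset.sum_const,
      Finset.card_range, nsmul_eq_mul]
    rcases Nat.eq_zero_or_pos n with rfl | hn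
    · simp
    · have : 0 < √(n : ℝ) := Real.sqrt_pos.2 (by exact_mod_cast hn)
      field_simp
      ring
  have := nullSingletonClass_gaussianReal (μ := 0) (v := 1) one_ne_zero
  have hport := ProbabilityMeasure.tendsto_measure_of_null_frontier_of_tendsto' hZ.tendsto
    (E := Set.Iic t) (by simp)
  simp only [ProbabilityMeasure.coe_mk, Measure.map_id] at hport
  have hreal := (ENNReal.tendsto_toReal (measure_ne_top (gaussianReal 0 1) (Set.Iic t))).comp hport
  rw [cdf_eq_real]
  refine hreal.congr fun n => ?_
  simp only [Function.comp_apply, Measure.real]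
  rw [Measure.map_apply (hZm n) measurableSet_Iic]
  rfl

end Probability

/-! ### Beliefs as random variables. -/

section Beliefs

variable {K Θ : Type*} [Fintype K] {X : K → Type*} [∀ k, MeasurableSpace (X k)]
  (M : ∀ k, LikelihoodModel Θ (X k)) (π : K → ℝ) (prior : K → Θ → ℝ)

theorem measurable_logMixRatio (θ₀ θ : Θ) : Measurable (logMixRatio M π θ₀ θ) :=
  Real.measurable_log.comp (Finset.measurable_fun_sum _ fun k _ =>
    ((measurable_likRatio (M k) θ₀ θ).comp (measurable_pi_apply k)).const_mul _)

variable [Fintype Θ]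

theorem measurable_beliefAA {Ω : Type*} {m : MeasurableSpace Ω} {ξ : ℕ → Ω → ∀ k, X k} (n : ℕ)
    (hξ : ∀ i < n, Measurable (ξ i)) (k : K) (θ : Θ) :
    Measurable fun ω => beliefAA M π prior (fun i => ξ i ω) n k θ := by
  induction n generalizing k θ with
  | zero => exact measurable_const
  | succ n ih =>
    have ih' := ih fun i hi => hξ i (hi.trans n.lt_succ_self)
    have hn (l : K) (θ' : Θ) : Measurable fun ω => (M l).lik θ' (ξ n ω l) :=
      ((M l).measurable_lik θ').comp ((measurable_pi_apply l).comp (hξ n n.lt_succ_self))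
    simp only [beliefAA, poolAA, adapt]
    exact Finset.measurable_fun_sum _ fun l _ => ((hn l θ).mul (ih' l θ)).div
      (Finset.measurable_fun_sum _ fun θ' _ => (hn l θ').mul (ih' l θ')) |>.const_mul _

variable {Ω : Type*} [MeasurableSpace Ω] {P : Measure Ω} {ξ : ℕ → Ω → ∀ k, X k}

theorem measurable_mixtureRatio_beliefAA (hξ : ∀ n, Measurable (ξ n)) (θ₀ : Θ) (n : ℕ) (k : K) :
    Measurable fun ω =>
      mixtureRatio (M k) θ₀ (beliefAA M π prior (fun i => ξ i ω) n k) (ξ n ω k) :=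
  Finset.measurable_fun_sum _ fun θ' _ =>
    (measurable_beliefAA M π prior n (fun i _ => hξ i) k θ').mul
      ((measurable_likRatio (M k) θ₀ θ').comp ((measurable_pi_apply k).comp (hξ n)))

/-- The belief at time `n` is a function of the observations with index below `n`. -/
theorem indepFun_beliefAA (hξ : ∀ n, Measurable (ξ n)) (hindep : iIndepFun ξ P) (n : ℕ) (k : K)
    (θ : Θ) : IndepFun (fun ω => beliefAA M π prior (fun i => ξ i ω) n k θ) (ξ n) P := by
  have h := indep_iSup_of_disjoint (fun i => (hξ i).comap_le) hindep
    (S := Set.Iio n) (T := {n}) (by simp)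
  refine indep_of_indep_of_le_left (indep_of_indep_of_le_right h ?_) ?_
  · exact le_iSup₂_of_le n rfl le_rfl
  · refine Measurable.comap_le (measurable_beliefAA M π prior n (fun i hi => ?_) k θ)
    exact measurable_iff_comap_le.2 (le_iSup₂_of_le (f := fun i (_ : i ∈ Set.Iio n) =>
      MeasurableSpace.comap (ξ i) inferInstance) i hi le_rfl)

variable {M π prior} {θ₀ : Θ}

/-- Independence factors each term, each likelihood ratio has mean at most `1`, and the beliefs sum
to at most `1`. -/
theorem lintegral_mixtureRatio_beliefAA_le_one [IsProbabilityMeasure P] (hπ : ∀ k, 0 < π k)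
    (hsum : ∑ k, π k = 1) (hprior : ∀ k, prior k ∈ stdSimplex ℝ Θ) (hξ : ∀ n, Measurable (ξ n))
    (hindep : iIndepFun ξ P) (hlaw : ∀ n k, P.map (fun ω => ξ n ω k) = (M k).law θ₀)
    (n : ℕ) (k : K) :
    ∫⁻ ω, ENNReal.ofReal (mixtureRatio (M k) θ₀ (beliefAA M π prior (fun i => ξ i ω) n k)
      (ξ n ω k)) ∂P ≤ 1 := by
  have hb (ω : Ω) := beliefAA_nonneg (M := M) (x := fun i => ξ i ω) hπ hprior
  have hbm := measurable_beliefAA M π prior n (fun i _ => hξ i) k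
  have hξk : Measurable fun ω => ξ n ω k := (measurable_pi_apply k).comp (hξ n)
  have hrm (θ' : Θ) := (measurable_likRatio (M k) θ₀ θ').ennreal_ofReal
  have hrξ (θ' : Θ) : Measurable fun ω => ENNReal.ofReal (likRatio (M k) θ₀ θ' (ξ n ω k)) :=
    (hrm θ').comp hξk
  have hmul (θ' : Θ) : Measurable fun ω => ENNReal.ofReal
      (beliefAA M π prior (fun i => ξ i ω) n k θ') *
        ENNReal.ofReal (likRatio (M k) θ₀ θ' (ξ n ω k)) :=
    (hbm θ').ennreal_ofReal.mul (hrξ θ')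
  calc ∫⁻ ω, ENNReal.ofReal (mixtureRatio (M k) θ₀ (beliefAA M π prior (fun i => ξ i ω) n k)
        (ξ n ω k)) ∂P
      = ∑ θ', ∫⁻ ω, ENNReal.ofReal (beliefAA M π prior (fun i => ξ i ω) n k θ') *
          ENNReal.ofReal (likRatio (M k) θ₀ θ' (ξ n ω k)) ∂P := by
        rw [← lintegral_finsetSum _ fun θ' _ => hmul θ']
        refine lintegral_congr fun ω => ?_
        rw [mixtureRatio, ENNReal.ofReal_sum_of_nonneg fun θ' _ =>
          mul_nonneg (hb ω n k θ') (likRatio_nonneg _ _ _ _)]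
        exact Finset.sum_congr rfl fun θ' _ => ENNReal.ofReal_mul (hb ω n k θ')
    _ ≤ ∑ θ', ∫⁻ ω, ENNReal.ofReal (beliefAA M π prior (fun i => ξ i ω) n k θ') ∂P := by
        refine Finset.sum_le_sum fun θ' _ => ?_
        rw [lintegral_mul_eq_lintegral_mul_lintegral_of_indepFun''
          (hbm θ').ennreal_ofReal.aemeasurable (hrξ θ').aemeasurable
          ((indepFun_beliefAA M π prior hξ hindep n k θ').comp ENNReal.measurable_ofReal
            ((hrm θ').comp (measurable_pi_apply k)))]
        refine mul_le_of_le_one_right' ?_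
        rw [← lintegral_map (hrm θ') hξk, hlaw]
        exact lintegral_likRatio_le_one (M k) θ₀ θ'
    _ = ∫⁻ ω, ENNReal.ofReal (∑ θ', beliefAA M π prior (fun i => ξ i ω) n k θ') ∂P := by
        rw [← lintegral_finsetSum _ fun θ' _ => (hbm θ').ennreal_ofReal]
        exact lintegral_congr fun ω => (ENNReal.ofReal_sum_of_nonneg fun θ' _ => hb ω n k θ').symm
    _ ≤ ∫⁻ _, 1 ∂P := lintegral_mono fun ω =>
        ENNReal.ofReal_le_one.2 (sum_beliefAA_le_one hπ hsum hprior n k)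
    _ = 1 := by simp

theorem integrable_mixtureRatio_beliefAA [IsProbabilityMeasure P] (hπ : ∀ k, 0 < π k)
    (hsum : ∑ k, π k = 1) (hprior : ∀ k, prior k ∈ stdSimplex ℝ Θ) (hξ : ∀ n, Measurable (ξ n))
    (hindep : iIndepFun ξ P) (hlaw : ∀ n k, P.map (fun ω => ξ n ω k) = (M k).law θ₀)
    (n : ℕ) (k : K) :
    Integrable (fun ω => mixtureRatio (M k) θ₀ (beliefAA M π prior (fun i => ξ i ω) n k)
      (ξ n ω k)) P := by
  refine ⟨(measurable_mixtureRatio_beliefAA M π prior hξ θ₀ n k).aestronglyMeasurable, ?_⟩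
  rw [hasFiniteIntegral_iff_ofReal (ae_of_all _ fun ω =>
    mixtureRatio_nonneg (M k) (beliefAA_nonneg hπ hprior n k) θ₀ _)]
  exact (lintegral_mixtureRatio_beliefAA_le_one hπ hsum hprior hξ hindep hlaw n k).trans_lt
    ENNReal.one_lt_top

theorem integral_mixtureRatio_beliefAA_le_one [IsProbabilityMeasure P] (hπ : ∀ k, 0 < π k)
    (hsum : ∑ k, π k = 1) (hprior : ∀ k, prior k ∈ stdSimplex ℝ Θ) (hξ : ∀ n, Measurable (ξ n))
    (hindep : iIndepFun ξ P) (hlaw : ∀ n k, P.map (fun ω => ξ n ω k) = (M k).law θ₀)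
    (n : ℕ) (k : K) :
    ∫ ω, mixtureRatio (M k) θ₀ (beliefAA M π prior (fun i => ξ i ω) n k) (ξ n ω k) ∂P ≤ 1 := by
  rw [integral_eq_lintegral_of_nonneg_ae (ae_of_all _ fun ω =>
    mixtureRatio_nonneg (M k) (beliefAA_nonneg hπ hprior n k) θ₀ _)
    (measurable_mixtureRatio_beliefAA M π prior hξ θ₀ n k).aestronglyMeasurable]
  exact ENNReal.toReal_le_of_le_ofReal zero_le_one (by
    simpa using lintegral_mixtureRatio_beliefAA_le_one hπ hsum hprior hξ hindep hlaw n k)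

theorem ae_summable_one_sub_sqrt_mixtureRatio_sq [IsProbabilityMeasure P] (hπ : ∀ k, 0 < π k)
    (hsum : ∑ k, π k = 1) (hprior : ∀ k, prior k ∈ stdSimplex ℝ Θ) (hξ : ∀ n, Measurable (ξ n))
    (hindep : iIndepFun ξ P) (hlaw : ∀ n k, P.map (fun ω => ξ n ω k) = (M k).law θ₀)
    (h₀ : ∀ᵐ ω ∂P, ∀ n k, 0 < (M k).lik θ₀ (ξ n ω k)) (hex : ∃ k, 0 < prior k θ₀) :
    ∀ᵐ ω ∂P, Summable fun j => ∑ k, π k * (1 - √(mixtureRatio (M k) θ₀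
      (beliefAA M π prior (fun i => ξ i ω) (j + 1) k) (ξ (j + 1) ω k))) ^ 2 := by
  obtain ⟨k₀, hk₀⟩ := hex
  set z : ℕ → K → Ω → ℝ := fun n k ω =>
    mixtureRatio (M k) θ₀ (beliefAA M π prior (fun i => ξ i ω) n k) (ξ n ω k) with hz
  have hzm (n : ℕ) (k : K) : Measurable (z n k) :=
    measurable_mixtureRatio_beliefAA M π prior hξ θ₀ n k
  have hz0 (n : ℕ) (k : K) (ω : Ω) : 0 ≤ z n k ω :=
    mixtureRatio_nonneg (M k) (beliefAA_nonneg hπ hprior n k) θ₀ _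
  have hzi (n : ℕ) (k : K) : Integrable (z n k) P :=
    integrable_mixtureRatio_beliefAA hπ hsum hprior hξ hindep hlaw n k
  have hz1 (n : ℕ) (k : K) : ∫ ω, z n k ω ∂P ≤ 1 :=
    integral_mixtureRatio_beliefAA_le_one hπ hsum hprior hξ hindep hlaw n k
  have hGm (n : ℕ) (k : K) : Measurable fun ω => (1 - √(z n k ω)) ^ 2 :=
    ((hzm n k).sqrt.const_sub 1).pow_const 2
  have hGi (n : ℕ) (k : K) : Integrable (fun ω => (1 - √(z n k ω)) ^ 2) P := by
    refine ((integrable_const (1 : ℝ)).add (hzi n k)).mono' (hGm n k).aestronglyMeasurable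
      (ae_of_all _ fun ω => ?_)
    rw [Real.norm_eq_abs, abs_of_nonneg (sq_nonneg _), Pi.add_apply]
    nlinarith [Real.sq_sqrt (hz0 n k ω), Real.sqrt_nonneg (z n k ω)]
  have hSi (n : ℕ) : Integrable (fun ω => ∑ k, π k * (1 - √(z n k ω)) ^ 2) P :=
    integrable_finsetSum _ fun k _ => (hGi n k).const_mul _
  have hDi (n : ℕ) : Integrable (fun ω => ∑ k, π k * (z n k ω - 1)) P :=
    integrable_finsetSum _ fun k _ => ((hzi n k).sub (integrable_const _)).const_mul _
  refine ae_summable_of_integral_sum_le (C := -Real.log (π k₀ * prior k₀ θ₀) + 1)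
    (fun n ω => Finset.sum_nonneg fun k _ => mul_nonneg (hπ k).le (sq_nonneg _))
    (fun n => Finset.measurable_fun_sum _ fun k _ => (hGm (n + 1) k).const_mul _)
    (fun n => hSi (n + 1)) fun N => ?_
  have hDs : Integrable (fun ω => ∑ j ∈ Finset.range N, ∑ k, π k * (z (j + 1) k ω - 1)) P :=
    integrable_finsetSum _ fun j _ => hDi (j + 1)
  have hCi : Integrable (fun ω => -Real.log (π k₀ * prior k₀ θ₀) + z 0 k₀ ω) P :=
    (integrable_const _).add (hzi 0 k₀)
  have hmono : ∫ ω, ∑ j ∈ Finset.range N, ∑ k, π k * (1 - √(z (j + 1) k ω)) ^ 2 ∂P ≤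
      ∫ ω, (-Real.log (π k₀ * prior k₀ θ₀) + z 0 k₀ ω +
        ∑ j ∈ Finset.range N, ∑ k, π k * (z (j + 1) k ω - 1)) ∂P := by
    refine integral_mono_ae (integrable_finsetSum _ fun j _ => hSi (j + 1)) (hCi.add hDs) ?_
    filter_upwards [h₀] with ω hω
    exact sum_mul_one_sub_sqrt_mixtureRatio_sq_le (x := fun i => ξ i ω) hπ hsum hprior hω hk₀ N
  have hDneg : ∫ ω, ∑ j ∈ Finset.range N, ∑ k, π k * (z (j + 1) k ω - 1) ∂P ≤ 0 := by
    rw [integral_finsetSum _ fun j _ => hDi (j + 1)]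
    refine Finset.sum_nonpos fun j _ => ?_
    have hd (k : K) : Integrable (fun ω => π k * (z (j + 1) k ω - 1)) P :=
      ((hzi (j + 1) k).sub (integrable_const _)).const_mul _
    rw [integral_finsetSum _ fun k _ => hd k]
    refine Finset.sum_nonpos fun k _ => ?_
    rw [integral_const_mul, integral_sub (hzi _ k) (integrable_const _)]
    refine mul_nonpos_of_nonneg_of_nonpos (hπ k).le ?_
    simpa using hz1 (j + 1) k
  rw [integral_add hCi hDs, integral_add (integrable_const _) (hzi 0 k₀)] at hmono
  simp only [integral_const, probReal_univ, one_smul] at hmono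
  linarith [hz1 0 k₀]

end Beliefs

/-! ### The main theorem. -/

theorem lemma1
    {K Θ : Type*} [Fintype K] [Fintype Θ]
    {X : K → Type*} [∀ k, MeasurableSpace (X k)]
    {Ω : Type*} [MeasurableSpace Ω] (P : Measure Ω) [IsProbabilityMeasure P]
    (M : ∀ k, LikelihoodModel Θ (X k))
    -- confidence weights
    (π : K → ℝ) (hπ_pos : ∀ k, 0 < π k) (hπ_sum : ∑ k, π k = 1)
    -- the true hypothesis and the observations `ξ n ω k` of agent `k` at time `n + 1`
    (θ₀ : Θ) (ξ : ℕ → Ω → ∀ k, X k) (hξ_meas : ∀ n, Measurable (ξ n))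
    -- i.i.d. over time, arbitrary dependence between agents, given marginals
    (hξ_indep : iIndepFun ξ P) (hξ_ident : ∀ n, IdentDistrib (ξ n) (ξ 0) P P)
    (hξ_law : ∀ n k, P.map (fun ω => ξ n ω k) = (M k).law θ₀)
    -- finite information about the true hypothesis
    (hfin : ∀ k θ', InformationTheory.klDiv ((M k).law θ₀) ((M k).law θ') < ∞)
    -- global identifiability
    (hident : ∀ θ', θ' ≠ θ₀ →
      ∃ k, 0 < InformationTheory.klDiv ((M k).law θ₀) ((M k).law θ'))
    -- a wrong hypothesis
    (θ : Θ) (hθ : θ ≠ θ₀)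
    -- initial beliefs; neither the truth nor `θ` is discarded by all agents from the beginning
    (prior : K → Θ → ℝ) (hprior : ∀ k, prior k ∈ stdSimplex ℝ Θ)
    (hprior_true : ∃ k, 0 < prior k θ₀) (hprior_wrong : ∃ k, 0 < prior k θ)
    -- mean and standard deviation of `log (∑ k, π_k r_{k,i})`, which do not depend on the time
    (ρ σ : ℝ) (hρ : ρ = -∫ ω, logMixRatio M π θ₀ θ (ξ 0 ω) ∂P)
    (hσ : σ = √(Var[fun ω => logMixRatio M π θ₀ θ (ξ 0 ω); P]))
    (hσ_fin : evariance (fun ω => logMixRatio M π θ₀ θ (ξ 0 ω)) P < ∞)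
    (hσ_pos : 0 < σ) :
    ∀ (k : K) (t : ℝ),
      Tendsto
        (fun i : ℕ => P.real {ω |
          (Real.log (beliefAA M π prior (fun n => ξ n ω) i k θ) + ρ * i) / (σ * √(i : ℝ)) ≤ t})
        atTop (𝓝 (cdf (gaussianReal 0 1) t)) := by
  intro k t
  have hξk (n : ℕ) (k : K) : Measurable fun ω => ξ n ω k :=
    (measurable_pi_apply k).comp (hξ_meas n)
  -- Finite divergence gives absolute continuity, so almost surely no observed likelihood vanishes.
  have hpos (θ' : Θ) : ∀ᵐ ω ∂P, ∀ n k, 0 < (M k).lik θ' (ξ n ω k) := by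
    refine ae_all_iff.2 fun n => ae_all_iff.2 fun k => ?_
    have h := ae_law_lik_pos_of_klDiv_lt_top (M k) (hfin k θ')
    rw [← hξ_law n k] at h
    exact ae_of_ae_map (hξk n k).aemeasurable h
  have hm := measurable_logMixRatio M π θ₀ θ
  refine tendsto_cdf_gaussian_of_tendsto_sub_sum
    (Y := fun n ω => logMixRatio M π θ₀ θ (ξ n ω))
    (hξ_indep.comp (fun _ => logMixRatio M π θ₀ θ) fun _ => hm)
    (fun n => (hξ_ident n).comp hm)
    ((evariance_lt_top_iff_memLp (hm.comp (hξ_meas 0)).aestronglyMeasurable).1 hσ_fin)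
    hρ hσ hσ_pos
    (fun n => (measurable_beliefAA M π prior n (fun i _ => hξ_meas i) k θ).log) ?_ t
  filter_upwards [hpos θ₀, hpos θ, ae_summable_one_sub_sqrt_mixtureRatio_sq hπ_pos hπ_sum hprior
    hξ_meas hξ_indep hξ_law (hpos θ₀) hprior_true] with ω h₀ hθω hs
  exact tendsto_log_beliefAA_sub_sum_div_sqrt (x := fun i => ξ i ω) hπ_pos hprior h₀ hθω
    hprior_true hprior_wrong hs k
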